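/- Let $\ell,n,m_1,\dots,m_\ell$ be natural numbers, let $A_i:\mathbb{R}^n\to\mathbb{R}^{m_i}$ ($i=1,\dots,\ell$) be nonzero linear maps, let $C_i\subseteq\mathbb{R}^{m_i}$ be closed convex sets, and let $\bar v\in\mathbb{R}^n$. Put $D:=C_1\times\cdots\times C_\ell$, let $\sigma_D(y):=\sup_{z\in D}\langle z,y\rangle$ be its support function, and for $y=(y_1,\dots,y_\ell)\in\mathbb{R}^{m_1}\times\cdots\times\mathbb{R}^{m_\ell}$ (with the Euclidean norm) let $$d(y):=\tfrac12\Big\|\sum_{i=1}^\ell A_i^Ty_i-\bar v\Big\|^2-\tfrac12\|\bar v\|^2+\sigma_D(y),\qquad d^*:=\inf_y d(y),$$ and let $\operatorname{Arg\,min} d$ be the set of global minimizers of $d$. Consider the Dykstra-type projection algorithm: with $\gamma_i:=\lambda_{\max}(A_i^TA_i)$, set $y_i^0:=0$ for all $i$ and $x^0:=\bar v$; for $t=0,1,2,\dots$ set $x_0^{t+1}:=x^t$, compute for $i=1,\dots,\ell$ $$x_i^{t+1}:=(I-\gamma_i^{-1}A_i^TA_i)x_{i-1}^{t+1}+\gamma_i^{-1}A_i^T\operatorname{Proj}_{C_i}(\gamma_iy_i^t+A_ix_{i-1}^{t+1}),$$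 $$y_i^{t+1}:=y_i^t+\gamma_i^{-1}A_ix_{i-1}^{t+1}-\gamma_i^{-1}\operatorname{Proj}_{C_i}(\gamma_iy_i^t+A_ix_{i-1}^{t+1}),$$ and set $x^{t+1}:=x_\ell^{t+1}$, $y^{t+1}:=(y_1^{t+1},\dots,y_\ell^{t+1})$. Assume that $\bigcap_{i=1}^\ell A_i^{-1}(\operatorname{ri}C_i)\neq\emptyset$, where $\operatorname{ri}$ denotes the relative interior. Then $\operatorname{Arg\,min} d\neq\emptyset$ (so that $d^*$ is a minimum), and the dual iterates satisfy $d(y^t)\to d^*$ and $\operatorname{dist}(y^t,\operatorname{Arg\,min} d)\to0$ as $t\to\infty$ (no boundedness of $\{y^t\}$ is assumed). -/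

import Mathlib

open Filter Topology

noncomputable section

namespace DykstraMSF

/-- Euclidean space `ℝ^k`. -/
abbrev E (k : ℕ) : Type := EuclideanSpace ℝ (Fin k)

/-- The Euclidean product space `ℝ^{m_1} × ⋯ × ℝ^{m_ℓ} = ℝ^m` (with the 2-norm), the space of
dual vectors `y = (y_1, …, y_ℓ)`. -/
abbrev DualSpace {ℓ : ℕ} (m : Fin ℓ → ℕ) : Type := PiLp 2 (fun i => E (m i))

/-- The support function `σ_C(y) = sup {⟪z, y⟫ : z ∈ C}` with extended real values. -/
def supportFn {X : Type*} [NormedAddCommGroup X] [InnerProductSpace ℝ X] (C : Set X) (y : X) :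
    EReal :=
  ⨆ z ∈ C, ((inner ℝ z y : ℝ) : EReal)

/-- `p` is a nearest point of `C` to `x`. -/
def IsNearest {X : Type*} [NormedAddCommGroup X] (C : Set X) (x p : X) : Prop :=
  p ∈ C ∧ ∀ u ∈ C, ‖p - x‖ ≤ ‖u - x‖

/-- The projection `Proj_C(x)`: the nearest point of `C` to `x` (it exists and is unique for a
nonempty closed convex set in a Euclidean space, see `isNearest_proj` and `IsNearest.eq_proj`). -/
def proj {X : Type*} [NormedAddCommGroup X] (C : Set X) (x : X) : X :=
  Classical.epsilon (IsNearest C x)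

theorem isNearest_proj {k : ℕ} {C : Set (E k)} (hC : IsClosed C) (hne : C.Nonempty) (x : E k) :
    IsNearest C x (proj C x) := by
  refine Classical.epsilon_spec (p := IsNearest C x) ?_
  obtain ⟨p, hp, hd⟩ := hC.exists_infDist_eq_dist hne x
  refine ⟨p, hp, fun u hu => ?_⟩
  have h := Metric.infDist_le_dist_of_mem (x := x) hu
  rw [hd, dist_comm, dist_comm x u, dist_eq_norm, dist_eq_norm] at h
  exact h

theorem IsNearest.eq_proj {k : ℕ} {C : Set (E k)} (hC : IsClosed C) (hconv : Convex ℝ C)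
    {x p : E k} (hp : IsNearest C x p) : p = proj C x := by
  have hq := isNearest_proj hC ⟨p, hp.1⟩ x
  have heq : ‖p - x‖ = ‖proj C x - x‖ := le_antisymm (hp.2 _ hq.1) (hq.2 _ hp.1)
  have hmid := hp.2 _ (hconv hp.1 hq.1 (by norm_num : (0 : ℝ) ≤ 1 / 2)
    (by norm_num : (0 : ℝ) ≤ 1 / 2) (by norm_num))
  have hrw : (1 / 2 : ℝ) • p + (1 / 2 : ℝ) • proj C x - x
      = (1 / 2 : ℝ) • ((p - x) + (proj C x - x)) := by module
  rw [hrw, norm_smul, Real.norm_of_nonneg (by norm_num : (0 : ℝ) ≤ 1 / 2)] at hmid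
  have hpar := parallelogram_law_with_norm ℝ (p - x) (proj C x - x)
  have h0 : ‖p - x - (proj C x - x)‖ = 0 := by
    have h1 := norm_nonneg (p - x)
    have h2 := norm_nonneg (p - x - (proj C x - x))
    nlinarith
  have h3 : p - x - (proj C x - x) = 0 := norm_eq_zero.1 h0
  rwa [sub_sub_sub_cancel_right, sub_eq_zero] at h3

/-- The largest eigenvalue `λ_max(T)` of a (symmetric) linear operator. -/
def lambdaMax {k : ℕ} (T : E k →ₗ[ℝ] E k) : ℝ :=
  sSup {μ : ℝ | Module.End.HasEigenvalue T μ}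

/-- The step-size parameter `λ_max(Aᵀ A)` of a linear map `A`. -/
def stepParam {n k : ℕ} (A : E n →ₗ[ℝ] E k) : ℝ :=
  lambdaMax (LinearMap.adjoint A ∘ₗ A)

section Dual

variable {ℓ n : ℕ} {m : Fin ℓ → ℕ}

/-- The transpose of the stacked map `x ↦ (A_1 x, …, A_ℓ x)`: `y ↦ ∑ i, A_iᵀ y_i`. -/
def stackedTranspose (A : ∀ i, E n →ₗ[ℝ] E (m i)) (y : DualSpace m) : E n :=
  ∑ i, LinearMap.adjoint (A i) (y i)

/-- The product set `D = C_1 × ⋯ × C_ℓ`. -/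
def prodSet (C : ∀ i, Set (E (m i))) : Set (DualSpace m) :=
  {z | ∀ i, z i ∈ C i}

/-- The dual objective `d(y) = ½‖∑ A_iᵀ y_i - v‖² - ½‖v‖² + σ_D(y)`. -/
def dualObj (A : ∀ i, E n →ₗ[ℝ] E (m i)) (C : ∀ i, Set (E (m i))) (v : E n)
    (y : DualSpace m) : EReal :=
  ((1 / 2 * ‖stackedTranspose A y - v‖ ^ 2 - 1 / 2 * ‖v‖ ^ 2 : ℝ) : EReal)
    + supportFn (prodSet C) y

/-- The dual optimal value `d* = inf_y d(y)`. -/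
def dualOpt (A : ∀ i, E n →ₗ[ℝ] E (m i)) (C : ∀ i, Set (E (m i))) (v : E n) : EReal :=
  ⨅ y : DualSpace m, dualObj A C v y

/-- The set `Arg min d` of global minimizers of the dual objective. -/
def dualArgmin (A : ∀ i, E n →ₗ[ℝ] E (m i)) (C : ∀ i, Set (E (m i))) (v : E n) :
    Set (DualSpace m) :=
  {y | ∀ z, dualObj A C v y ≤ dualObj A C v z}

/-- The inner primal update: from `x_{i-1}` and `y_i`, with `γ = λ_max(Aᵀ A)`,
`x_i = (I - γ⁻¹ Aᵀ A) x_{i-1} + γ⁻¹ Aᵀ Proj_C (γ y_i + A x_{i-1})`. -/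
def stepX {k : ℕ} (A : E n →ₗ[ℝ] E k) (C : Set (E k)) (y : E k) (x : E n) : E n :=
  (x - (stepParam A)⁻¹ • LinearMap.adjoint A (A x))
    + (stepParam A)⁻¹ • LinearMap.adjoint A (proj C (stepParam A • y + A x))

/-- The inner dual update: `y_i + γ⁻¹ A x_{i-1} - γ⁻¹ Proj_C (γ y_i + A x_{i-1})`. -/
def stepY {k : ℕ} (A : E n →ₗ[ℝ] E k) (C : Set (E k)) (y : E k) (x : E n) : E k :=
  y + (stepParam A)⁻¹ • A x - (stepParam A)⁻¹ • proj C (stepParam A • y + A x)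

/-- The inner sweep `x_0, x_1, …, x_ℓ` of one outer iteration, started at `x_0 = x`
with the current dual vector `y`. -/
def sweep (A : ∀ i, E n →ₗ[ℝ] E (m i)) (C : ∀ i, Set (E (m i))) (y : DualSpace m) (x : E n) :
    Fin (ℓ + 1) → E n :=
  Fin.induction x (fun i xi => stepX (A i) (C i) (y i) xi)

/-- The outer iterates `(x^t, y^t)` of the Dykstra-type projection algorithm, started at
`x^0 = v`, `y^0 = 0`. In the inner step for the `i`-th set, `i.castSucc` indexes the
previous point `x^{t+1}_{i-1}` of the sweep. -/
def iterate (A : ∀ i, E n →ₗ[ℝ] E (m i)) (C : ∀ i, Set (E (m i))) (v : E n) :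
    ℕ → E n × DualSpace m
  | 0 => (v, 0)
  | t + 1 =>
    let s := iterate A C v t
    let xs := sweep A C s.2 s.1
    (xs (Fin.last ℓ), WithLp.toLp 2 (fun i => stepY (A i) (C i) (s.2 i) (xs i.castSucc)))

/-- The dual iterates `y^t` of the Dykstra-type projection algorithm. -/
def dualIter (A : ∀ i, E n →ₗ[ℝ] E (m i)) (C : ∀ i, Set (E (m i))) (v : E n) (t : ℕ) :
    DualSpace m :=
  (iterate A C v t).2

end Dual

end DykstraMSF

end

noncomputable section

namespace DykstraMSF

section Abstract

variable {F : Type*} [NormedAddCommGroup F] [InnerProductSpace ℝ F] [FiniteDimensional ℝ F]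

/-- A function invariant under translations by `K` takes the same value at the projection
onto `Kᗮ`. -/
theorem apply_starProjection_orthogonal {K : Submodule ℝ F} {f : F → EReal}
    (hinv : ∀ y, ∀ k ∈ K, f (y + k) = f y) (y : F) : f (Kᗮ.starProjection y) = f y := by
  have h : y - Kᗮ.starProjection y ∈ K := by
    have := Submodule.sub_starProjection_mem_orthogonal (K := Kᗮ) y
    rwa [Submodule.orthogonal_orthogonal] at this
  rw [← hinv _ _ h, add_sub_cancel]

theorem isCompact_sublevel_inter {K : Submodule ℝ F} {f : F → EReal}
    (hlsc : LowerSemicontinuous f) (r : EReal) {R : ℝ} (hR : ∀ y ∈ Kᗮ, f y ≤ r → ‖y‖ ≤ R) :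
    IsCompact {y | y ∈ Kᗮ ∧ f y ≤ r} := by
  refine Metric.isCompact_of_isClosed_isBounded ?_ ?_
  · exact (Submodule.closed_of_finiteDimensional Kᗮ).inter (hlsc.isClosed_preimage r)
  · exact (Metric.isBounded_closedBall (x := (0 : F)) (r := R)).subset
      fun y hy => by simpa using hR y hy.1 hy.2

theorem exists_minimizer_of_invariant {K : Submodule ℝ F} {f : F → EReal}
    (hlsc : LowerSemicontinuous f) (hinv : ∀ y, ∀ k ∈ K, f (y + k) = f y) {r : EReal}
    {R : ℝ} (hR : ∀ y ∈ Kᗮ, f y ≤ r → ‖y‖ ≤ R) (hr : ∃ y, f y ≤ r) :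
    ∃ y ∈ Kᗮ, ∀ z, f y ≤ f z := by
  obtain ⟨y₀, hy₀⟩ := hr
  have hmem : ∀ z, f z ≤ r → Kᗮ.starProjection z ∈ {y | y ∈ Kᗮ ∧ f y ≤ r} := fun z hz =>
    ⟨Submodule.starProjection_apply_mem _ _,
      by rwa [apply_starProjection_orthogonal hinv]⟩
  obtain ⟨y, hy, hmin⟩ := (hlsc.lowerSemicontinuousOn _).exists_isMinOn ⟨_, hmem y₀ hy₀⟩
    (isCompact_sublevel_inter hlsc r hR)
  refine ⟨y, hy.1, fun z => ?_⟩
  rcases le_total (f z) r with hz | hz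
  · rw [← apply_starProjection_orthogonal hinv z]
    exact hmin (hmem z hz)
  · exact hy.2.trans hz

theorem tendsto_infDist_argmin_of_invariant {K : Submodule ℝ F} {f : F → EReal}
    (hlsc : LowerSemicontinuous f) (hinv : ∀ y, ∀ k ∈ K, f (y + k) = f y) {r : EReal}
    {R : ℝ} (hR : ∀ y ∈ Kᗮ, f y ≤ r → ‖y‖ ≤ R) {u : ℕ → F} (hu : ∀ t, f (u t) ≤ r)
    (hlim : Tendsto (fun t => f (u t)) atTop (𝓝 (⨅ z, f z))) :
    Tendsto (fun t => Metric.infDist (u t) {y | ∀ z, f y ≤ f z}) atTop (𝓝 0) := by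
  set S : Set F := {y | ∀ z, f y ≤ f z} with hS
  have hSinv : ∀ y ∈ S, ∀ k ∈ K, y + k ∈ S := fun y hy k hk z => by
    rw [hinv y k hk]; exact hy z
  have hSne : S.Nonempty := by
    obtain ⟨y, -, hy⟩ := exists_minimizer_of_invariant hlsc hinv hR ⟨u 0, hu 0⟩
    exact ⟨y, hy⟩
  have hproj : ∀ y, Metric.infDist y S ≤ Metric.infDist (Kᗮ.starProjection y) S := by
    intro y
    refine (Metric.le_infDist hSne).2 fun s hs => ?_
    have hk : y - Kᗮ.starProjection y ∈ K := by
      have := Submodule.sub_starProjection_mem_orthogonal (K := Kᗮ) y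
      rwa [Submodule.orthogonal_orthogonal] at this
    refine (Metric.infDist_le_dist_of_mem (hSinv s hs _ hk)).trans (le_of_eq ?_)
    rw [dist_eq_norm, dist_eq_norm]
    congr 1
    abel
  refine squeeze_zero (fun _ => Metric.infDist_nonneg) (fun t => hproj (u t)) ?_
  rw [Metric.tendsto_atTop]
  intro ε hε
  have hcomp : IsCompact ({y | y ∈ Kᗮ ∧ f y ≤ r} ∩ {y | ε ≤ Metric.infDist y S}) :=
    (isCompact_sublevel_inter hlsc r hR).inter_right
      (isClosed_le continuous_const (Metric.continuous_infDist_pt S))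
  have hmem : ∀ t, Kᗮ.starProjection (u t) ∈ {y | y ∈ Kᗮ ∧ f y ≤ r} := fun t =>
    ⟨Submodule.starProjection_apply_mem _ _,
      by rw [apply_starProjection_orthogonal hinv]; exact hu t⟩
  suffices h : ∀ᶠ t in atTop, Metric.infDist (Kᗮ.starProjection (u t)) S < ε by
    obtain ⟨N, hN⟩ := eventually_atTop.1 h
    refine ⟨N, fun t ht => ?_⟩
    rw [Real.dist_0_eq_abs, abs_of_nonneg Metric.infDist_nonneg]
    exact hN t ht
  rcases Set.eq_empty_or_nonempty
    ({y | y ∈ Kᗮ ∧ f y ≤ r} ∩ {y | ε ≤ Metric.infDist y S}) with he | hne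
  · refine Eventually.of_forall fun t => not_le.1 fun hle => ?_
    have : Kᗮ.starProjection (u t) ∈ (∅ : Set F) := he ▸ ⟨hmem t, hle⟩
    exact this
  · obtain ⟨y, hy, hmin⟩ := (hlsc.lowerSemicontinuousOn _).exists_isMinOn hne hcomp
    have hlt : ⨅ z, f z < f y := by
      refine lt_of_not_ge fun hle => ?_
      have hyS : y ∈ S := fun z => hle.trans (iInf_le _ z)
      have h0 := hy.2
      simp only [Set.mem_ofPred_eq, Metric.infDist_zero_of_mem hyS] at h0
      linarith
    filter_upwards [hlim.eventually_lt_const hlt] with t ht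
    refine not_le.1 fun hle => ?_
    have h1 : f y ≤ f (Kᗮ.starProjection (u t)) := hmin ⟨hmem t, hle⟩
    rw [apply_starProjection_orthogonal hinv] at h1
    exact absurd ht (not_lt.2 h1)

end Abstract

section StepParam

variable {n k : ℕ}

theorem norm_sq_apply_le (A : E n →ₗ[ℝ] E k) (x : E n) : ‖A x‖ ^ 2 ≤ stepParam A * ‖x‖ ^ 2 := by
  have hT : (LinearMap.adjoint A ∘ₗ A).IsSymmetric := fun x y => by
    simp [LinearMap.adjoint_inner_left, LinearMap.adjoint_inner_right]
  have hn : Module.finrank ℝ (E n) = n := by simp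
  set b := hT.eigenvectorBasis hn with hb
  have h1 : ‖A x‖ ^ 2 = ∑ i, hT.eigenvalues hn i * (inner ℝ (b i) x) ^ 2 := by
    have : ‖A x‖ ^ 2 = inner ℝ x ((LinearMap.adjoint A ∘ₗ A) x) := by
      rw [LinearMap.comp_apply, LinearMap.adjoint_inner_right, real_inner_self_eq_norm_sq]
    rw [this, ← b.sum_inner_mul_inner]
    refine Finset.sum_congr rfl fun i _ => ?_
    have h2 := hT.eigenvectorBasis_apply_self_apply hn x i
    rw [OrthonormalBasis.repr_apply_apply, OrthonormalBasis.repr_apply_apply] at h2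
    rw [hb, h2, real_inner_comm]
    simp only [RCLike.ofReal_real_eq_id, id]
    ring
  have h3 : ‖x‖ ^ 2 = ∑ i, (inner ℝ (b i) x) ^ 2 := by
    rw [← b.sum_sq_norm_inner_right x]
    simp
  rw [h1, h3, Finset.mul_sum]
  refine Finset.sum_le_sum fun i _ => mul_le_mul_of_nonneg_right ?_ (sq_nonneg _)
  exact le_csSup (Module.End.finite_hasEigenvalue _).bddAbove
    (hT.hasEigenvalue_eigenvalues hn i)

theorem stepParam_pos {A : E n →ₗ[ℝ] E k} (hA : A ≠ 0) : 0 < stepParam A := by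
  obtain ⟨x, hx⟩ : ∃ x, A x ≠ 0 := by
    by_contra! h
    exact hA (LinearMap.ext h)
  have h1 := norm_sq_apply_le A x
  have h2 : 0 < ‖A x‖ ^ 2 := by positivity
  by_contra! h3
  nlinarith [mul_nonneg (neg_nonneg.2 h3) (sq_nonneg ‖x‖)]

theorem norm_sq_adjoint_apply_le (A : E n →ₗ[ℝ] E k) (y : E k) :
    ‖LinearMap.adjoint A y‖ ^ 2 ≤ stepParam A * ‖y‖ ^ 2 := by
  set w := LinearMap.adjoint A y with hw
  have h1 := norm_sq_apply_le A w
  have h2 : ‖w‖ ^ 2 = inner ℝ (A w) y := by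
    rw [← LinearMap.adjoint_inner_right, ← hw, real_inner_self_eq_norm_sq]
  have h3 : ‖w‖ ^ 2 ≤ ‖A w‖ * ‖y‖ := h2 ▸ real_inner_le_norm _ _
  rcases eq_or_ne w 0 with h0 | h0
  · by_cases hA : A = 0
    · subst hA
      have hs : 0 ≤ stepParam (0 : E n →ₗ[ℝ] E k) := by
        refine Real.sSup_nonneg fun μ hμ => ?_
        obtain ⟨v, hv⟩ := (Module.End.HasEigenvalue.exists_hasEigenvector hμ)
        have h5 := hv.apply_eq_smul
        simp only [LinearMap.comp_zero, LinearMap.zero_apply] at h5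
        rcases smul_eq_zero.1 h5.symm with h6 | h6
        · exact h6.ge
        · exact absurd h6 hv.2
      rw [h0]
      simp only [norm_zero, ne_eq, OfNat.ofNat_ne_zero, not_false_eq_true, zero_pow]
      positivity
    · have := (stepParam_pos hA).le
      rw [h0]
      simp only [norm_zero, ne_eq, OfNat.ofNat_ne_zero, not_false_eq_true, zero_pow]
      positivity
  · have h4 : 0 < ‖w‖ ^ 2 := by positivity
    have h5 : (‖w‖ ^ 2) ^ 2 ≤ ‖A w‖ ^ 2 * ‖y‖ ^ 2 := by
      rw [← mul_pow]
      exact pow_le_pow_left₀ h4.le h3 2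
    have h6 : ‖A w‖ ^ 2 * ‖y‖ ^ 2 ≤ stepParam A * ‖w‖ ^ 2 * ‖y‖ ^ 2 :=
      mul_le_mul_of_nonneg_right h1 (sq_nonneg _)
    refine le_of_mul_le_mul_left ?_ h4
    nlinarith

end StepParam

section Projection

variable {k : ℕ}

theorem inner_sub_proj_le_zero {C : Set (E k)} (hC : IsClosed C) (hconv : Convex ℝ C)
    (hne : C.Nonempty) (x : E k) {z : E k} (hz : z ∈ C) :
    inner ℝ (x - proj C x) (z - proj C x) ≤ 0 := by
  have hp := isNearest_proj hC hne x
  refine (norm_eq_iInf_iff_real_inner_le_zero hconv hp.1).1 ?_ z hz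
  have : Nonempty C := hne.to_subtype
  refine le_antisymm (le_ciInf fun w => ?_) ?_
  · rw [norm_sub_rev, norm_sub_rev x]
    exact hp.2 w w.2
  · exact ciInf_le (f := fun w : C => ‖x - w‖) ⟨0, by rintro _ ⟨w, rfl⟩; exact norm_nonneg _⟩
      ⟨_, hp.1⟩

end Projection

section Objective

variable {ℓ n : ℕ} {m : Fin ℓ → ℕ}

theorem dualObj_eq_biSup (A : ∀ i, E n →ₗ[ℝ] E (m i)) (C : ∀ i, Set (E (m i))) (v : E n)
    (y : DualSpace m) : dualObj A C v y = ⨆ z ∈ prodSet C,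
      ((1 / 2 * ‖stackedTranspose A y - v‖ ^ 2 - 1 / 2 * ‖v‖ ^ 2 + inner ℝ z y : ℝ) : EReal) := by
  unfold dualObj supportFn
  set q : ℝ := 1 / 2 * ‖stackedTranspose A y - v‖ ^ 2 - 1 / 2 * ‖v‖ ^ 2
  apply le_antisymm
  · rw [add_comm, ← EReal.le_sub_iff_add_le (Or.inl (EReal.coe_ne_bot q))
      (Or.inl (EReal.coe_ne_top q))]
    refine iSup₂_le fun z hz => ?_
    rw [EReal.le_sub_iff_add_le (Or.inl (EReal.coe_ne_bot q)) (Or.inl (EReal.coe_ne_top q)),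
      add_comm, ← EReal.coe_add]
    exact le_iSup₂ (f := fun z (_ : z ∈ prodSet C) => ((q + inner ℝ z y : ℝ) : EReal)) z hz
  · refine iSup₂_le fun z hz => ?_
    rw [EReal.coe_add]
    exact add_le_add le_rfl
      (le_iSup₂ (f := fun z (_ : z ∈ prodSet C) => ((inner ℝ z y : ℝ) : EReal)) z hz)

theorem le_dualObj (A : ∀ i, E n →ₗ[ℝ] E (m i)) {C : ∀ i, Set (E (m i))} (v : E n)
    (y : DualSpace m) {z : DualSpace m} (hz : z ∈ prodSet C) :
    ((1 / 2 * ‖stackedTranspose A y - v‖ ^ 2 - 1 / 2 * ‖v‖ ^ 2 + inner ℝ z y : ℝ) : EReal)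
      ≤ dualObj A C v y := by
  rw [dualObj_eq_biSup]
  exact le_iSup₂ (f := fun z (_ : z ∈ prodSet C) =>
    ((1 / 2 * ‖stackedTranspose A y - v‖ ^ 2 - 1 / 2 * ‖v‖ ^ 2 + inner ℝ z y : ℝ) : EReal)) z hz

/-- If `p ∈ D` attains the support function at `y`, the dual objective is given by `p`. -/
theorem dualObj_eq_of_attained (A : ∀ i, E n →ₗ[ℝ] E (m i)) {C : ∀ i, Set (E (m i))} (v : E n)
    {y p : DualSpace m} (hp : p ∈ prodSet C)
    (hmax : ∀ z ∈ prodSet C, (inner ℝ z y : ℝ) ≤ inner ℝ p y) :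
    dualObj A C v y =
      ((1 / 2 * ‖stackedTranspose A y - v‖ ^ 2 - 1 / 2 * ‖v‖ ^ 2 + inner ℝ p y : ℝ) : EReal) := by
  refine le_antisymm ?_ (le_dualObj A v y hp)
  rw [dualObj_eq_biSup]
  exact iSup₂_le fun z hz => EReal.coe_le_coe_iff.2 (by linarith [hmax z hz])

theorem continuous_stackedTranspose (A : ∀ i, E n →ₗ[ℝ] E (m i)) :
    Continuous (stackedTranspose A) := by
  unfold stackedTranspose
  refine continuous_finsetSum _ fun i _ => ?_
  exact (LinearMap.continuous_of_finiteDimensional _).comp (PiLp.continuous_apply 2 _ i)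

theorem lowerSemicontinuous_dualObj (A : ∀ i, E n →ₗ[ℝ] E (m i)) (C : ∀ i, Set (E (m i)))
    (v : E n) : LowerSemicontinuous (dualObj A C v) := by
  have h : dualObj A C v = fun y => ⨆ z ∈ prodSet C,
      ((1 / 2 * ‖stackedTranspose A y - v‖ ^ 2 - 1 / 2 * ‖v‖ ^ 2 + inner ℝ z y : ℝ) : EReal) :=
    funext (dualObj_eq_biSup A C v)
  rw [h]
  refine lowerSemicontinuous_biSup fun z _ => Continuous.lowerSemicontinuous ?_
  have := continuous_stackedTranspose A
  exact continuous_coe_real_ereal.comp (by fun_prop)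

theorem stackedTranspose_add (A : ∀ i, E n →ₗ[ℝ] E (m i)) (y z : DualSpace m) :
    stackedTranspose A (y + z) = stackedTranspose A y + stackedTranspose A z := by
  simp [stackedTranspose, Finset.sum_add_distrib]

theorem stackedTranspose_smul (A : ∀ i, E n →ₗ[ℝ] E (m i)) (c : ℝ) (y : DualSpace m) :
    stackedTranspose A (c • y) = c • stackedTranspose A y := by
  simp [stackedTranspose, Finset.smul_sum]

/-- `stackedTranspose A` is the adjoint of the stacked map. -/
theorem inner_stackedTranspose (A : ∀ i, E n →ₗ[ℝ] E (m i)) (x : E n) (y : DualSpace m) :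
    inner ℝ x (stackedTranspose A y) = ∑ i, inner ℝ (A i x) (y i) := by
  simp [stackedTranspose, inner_sum, LinearMap.adjoint_inner_right]

end Objective

theorem exists_add_mem_of_mem_intrinsicInterior {k : ℕ} {C : Set (E k)} {x : E k}
    (hx : x ∈ intrinsicInterior ℝ C) :
    ∃ ε > 0, ∀ u ∈ vectorSpan ℝ C, ‖u‖ ≤ ε → x + u ∈ C := by
  obtain ⟨y, hy, rfl⟩ := mem_intrinsicInterior.1 hx
  obtain ⟨ε, hε, hball⟩ := Metric.mem_nhds_iff.1 (mem_interior_iff_mem_nhds.1 hy)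
  refine ⟨ε / 2, by positivity, fun u hu hnu => ?_⟩
  have hmem : (y : E k) + u ∈ affineSpan ℝ C := by
    rw [add_comm]
    exact AffineSubspace.vadd_mem_of_mem_direction (by rwa [direction_affineSpan]) y.2
  have : (⟨(y : E k) + u, hmem⟩ : affineSpan ℝ C) ∈ Metric.ball y ε := by
    rw [Metric.mem_ball, Subtype.dist_eq, dist_eq_norm]
    simp only [add_sub_cancel_left]
    linarith
  exact hball this

section Coercive

variable {ℓ n : ℕ} {m : Fin ℓ → ℕ}

theorem dual_inner_eq_sum (z y : DualSpace m) : (inner ℝ z y : ℝ) = ∑ i, inner ℝ (z i) (y i) :=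
  PiLp.inner_apply z y

/-- The linear map through which the dual objective factors: the stacked transpose together
with the projections onto the directions of the affine hulls. -/
def factorMap (A : ∀ i, E n →ₗ[ℝ] E (m i)) (C : ∀ i, Set (E (m i))) :
    DualSpace m →ₗ[ℝ] E n × (∀ i, E (m i)) where
  toFun y := (stackedTranspose A y, fun i => (vectorSpan ℝ (C i)).starProjection (y i))
  map_add' y z := by
    ext1
    · exact stackedTranspose_add A y z
    · funext i; simp
  map_smul' c y := by
    ext1
    · exact stackedTranspose_smul A c y
    · funext i; simp

theorem inner_eq_zero_of_mem_ker {A : ∀ i, E n →ₗ[ℝ] E (m i)} {C : ∀ i, Set (E (m i))}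
    {x₀ : E n} (hx₀ : ∀ i, A i x₀ ∈ C i) {k : DualSpace m} (hk : k ∈ (factorMap A C).ker)
    {z : DualSpace m} (hz : z ∈ prodSet C) : (inner ℝ z k : ℝ) = 0 := by
  have hk' : factorMap A C k = 0 := hk
  have h1 : stackedTranspose A k = 0 := congrArg Prod.fst hk'
  have h2 : ∀ i, (vectorSpan ℝ (C i)).starProjection (k i) = 0 := fun i =>
    congrFun (congrArg Prod.snd hk') i
  have h3 : ∑ i, inner ℝ (A i x₀) (k i) = 0 := by
    rw [← inner_stackedTranspose, h1, inner_zero_right]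
  rw [dual_inner_eq_sum, ← h3]
  refine Finset.sum_congr rfl fun i _ => ?_
  have hmem : z i - A i x₀ ∈ vectorSpan ℝ (C i) := vsub_mem_vectorSpan ℝ (hz i) (hx₀ i)
  have h4 : (inner ℝ (z i - A i x₀) (k i) : ℝ) = 0 := by
    rw [← (Submodule.starProjection_eq_self_iff).2 hmem,
      Submodule.inner_starProjection_left_eq_right, h2, inner_zero_right]
  rw [inner_sub_left] at h4
  linarith

theorem dualObj_add_of_mem_ker {A : ∀ i, E n →ₗ[ℝ] E (m i)} {C : ∀ i, Set (E (m i))} (v : E n)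
    {x₀ : E n} (hx₀ : ∀ i, A i x₀ ∈ C i) (y k : DualSpace m) (hk : k ∈ (factorMap A C).ker) :
    dualObj A C v (y + k) = dualObj A C v y := by
  have h1 : stackedTranspose A k = 0 := congrArg Prod.fst (show factorMap A C k = 0 from hk)
  rw [dualObj_eq_biSup, dualObj_eq_biSup]
  refine biSup_congr fun z hz => ?_
  rw [stackedTranspose_add, h1, add_zero, inner_add_right, inner_eq_zero_of_mem_ker hx₀ hk hz,
    add_zero]

theorem exists_bound_of_dualObj_le_zero {A : ∀ i, E n →ₗ[ℝ] E (m i)} {C : ∀ i, Set (E (m i))}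
    (v : E n) {x₀ : E n} (hx₀ : ∀ i, A i x₀ ∈ intrinsicInterior ℝ (C i)) :
    ∃ R, ∀ y ∈ (factorMap A C).kerᗮ, dualObj A C v y ≤ 0 → ‖y‖ ≤ R := by
  choose ε hε hball using fun i => exists_add_mem_of_mem_intrinsicInterior (hx₀ i)
  set K := (factorMap A C).ker with hK
  have hker : ((factorMap A C).domRestrict Kᗮ).ker = ⊥ := by
    rw [LinearMap.ker_eq_bot']
    intro y hy
    have h1 : (y : DualSpace m) ∈ K := hy
    have h2 := Submodule.inner_right_of_mem_orthogonal h1 y.2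
    exact Subtype.ext (inner_self_eq_zero.1 h2)
  obtain ⟨c, -, hc⟩ := ((factorMap A C).domRestrict Kᗮ).exists_antilipschitzWith hker
  set a := ‖v - x₀‖ with ha
  refine ⟨c * (2 * a + ∑ i, 2 * a ^ 2 / ε i), fun y hy hle => ?_⟩
  set w := stackedTranspose A y with hw
  set P : ∀ i, E (m i) := fun i => (vectorSpan ℝ (C i)).starProjection (y i) with hP
  set z : DualSpace m := WithLp.toLp 2 fun i => A i x₀ + (ε i / ‖P i‖) • P i with hz
  have hzmem : z ∈ prodSet C := fun i => by
    refine hball i _ (Submodule.smul_mem _ _ (Submodule.starProjection_apply_mem _ _)) ?_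
    rw [norm_smul, Real.norm_of_nonneg (div_nonneg (hε i).le (norm_nonneg _))]
    rcases eq_or_ne ‖P i‖ 0 with h | h
    · rw [h]; simpa using (hε i).le
    · rw [div_mul_cancel₀ _ h]
  have hzy : (inner ℝ z y : ℝ) = inner ℝ x₀ w + ∑ i, ε i * ‖P i‖ := by
    rw [dual_inner_eq_sum, hw, inner_stackedTranspose, ← Finset.sum_add_distrib]
    refine Finset.sum_congr rfl fun i _ => ?_
    have h1 : (inner ℝ (P i) (y i) : ℝ) = ‖P i‖ ^ 2 := by
      rw [← real_inner_self_eq_norm_sq]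
      have h2 : P i = (vectorSpan ℝ (C i)).starProjection (P i) :=
        ((Submodule.starProjection_eq_self_iff).2 (Submodule.starProjection_apply_mem _ _)).symm
      conv_lhs => rw [h2]
      rw [Submodule.inner_starProjection_left_eq_right]
    rw [hz]
    simp only
    rw [inner_add_left, real_inner_smul_left, h1]
    rcases eq_or_ne ‖P i‖ 0 with h | h
    · rw [h]; simp
    · field_simp
  have hq := (le_dualObj A v y hzmem).trans hle
  rw [← EReal.coe_zero, EReal.coe_le_coe_iff, hzy, ← hw, norm_sub_sq_real] at hq
  have h1 : (inner ℝ w v : ℝ) - inner ℝ x₀ w ≤ ‖w‖ * a := by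
    rw [real_inner_comm w x₀, ← inner_sub_right]
    exact real_inner_le_norm _ _
  have hnn : ∀ i, 0 ≤ ε i * ‖P i‖ := fun i => mul_nonneg (hε i).le (norm_nonneg _)
  have hsum : 0 ≤ ∑ i, ε i * ‖P i‖ := Finset.sum_nonneg fun i _ => hnn i
  have ha0 : 0 ≤ a := norm_nonneg _
  have hw0 : 0 ≤ ‖w‖ := norm_nonneg _
  have hwle : ‖w‖ ≤ 2 * a := by
    by_contra! h
    nlinarith
  have hsle : ∑ i, ε i * ‖P i‖ ≤ 2 * a ^ 2 := by nlinarith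
  have hPle : ∀ i, ‖P i‖ ≤ 2 * a ^ 2 / ε i := fun i => by
    rw [le_div_iff₀ (hε i), mul_comm]
    exact (Finset.single_le_sum (fun j _ => hnn j) (Finset.mem_univ i)).trans hsle
  have hdn : ∀ i, 0 ≤ 2 * a ^ 2 / ε i := fun i => by have := hε i; positivity
  have hS0 : 0 ≤ ∑ i, 2 * a ^ 2 / ε i := Finset.sum_nonneg fun i _ => hdn i
  have hT : ‖factorMap A C y‖ ≤ 2 * a + ∑ i, 2 * a ^ 2 / ε i := by
    refine max_le (hwle.trans (by linarith)) ?_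
    refine (pi_norm_le_iff_of_nonneg (by positivity)).2 fun i => (hPle i).trans ?_
    have := Finset.single_le_sum (fun j _ => hdn j) (Finset.mem_univ i)
    linarith
  have h2 := hc.le_mul_dist ⟨y, hy⟩ 0
  rw [map_zero, dist_zero_right, dist_zero_right] at h2
  exact h2.trans (mul_le_mul_of_nonneg_left hT c.2)

end Coercive

section Step

variable {n k : ℕ} {A : E n →ₗ[ℝ] E k} {C : Set (E k)}

theorem stepX_eq_sub (y : E k) (x : E n) :
    stepX A C y x = x - LinearMap.adjoint A (stepY A C y x - y) := by
  simp only [stepX, stepY, map_sub, map_add, map_smul]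
  abel

theorem apply_eq_proj_add (hA : A ≠ 0) (y : E k) (x : E n) :
    A x = proj C (stepParam A • y + A x) + stepParam A • (stepY A C y x - y) := by
  have h := (stepParam_pos hA).ne'
  simp only [stepY, smul_sub, smul_add, smul_smul, mul_inv_cancel₀ h, one_smul]
  abel

/-- The projected point attains the support function of `C` at the updated dual block. -/
theorem inner_stepY_le (hA : A ≠ 0) (hC : IsClosed C) (hconv : Convex ℝ C) (y : E k) (x : E n)
    {z : E k} (hz : z ∈ C) : (inner ℝ z (stepY A C y x) : ℝ) ≤
      inner ℝ (proj C (stepParam A • y + A x)) (stepY A C y x) := by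
  have h := inner_sub_proj_le_zero hC hconv ⟨z, hz⟩ (stepParam A • y + A x) hz
  have h1 : stepParam A • y + A x - proj C (stepParam A • y + A x)
      = stepParam A • stepY A C y x := by
    conv_lhs => rw [add_sub_assoc]; rhs; lhs; rw [apply_eq_proj_add (C := C) hA y x]
    rw [smul_sub]
    abel
  rw [h1, real_inner_smul_left, real_inner_comm, inner_sub_left] at h
  have := stepParam_pos hA
  by_contra! hlt
  nlinarith

theorem block_descent (hA : A ≠ 0) (hC : IsClosed C) {y p : E k} (x : E n)
    (hp : ∀ z ∈ C, (inner ℝ z y : ℝ) ≤ inner ℝ p y) (hne : C.Nonempty) :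
    1 / 2 * ‖stepX A C y x‖ ^ 2
        + inner ℝ (proj C (stepParam A • y + A x)) (stepY A C y x)
        + stepParam A / 2 * ‖stepY A C y x - y‖ ^ 2
      ≤ 1 / 2 * ‖x‖ ^ 2 + inner ℝ p y := by
  have hmem := (isNearest_proj hC hne (stepParam A • y + A x)).1
  have h1 := hp _ hmem
  have h2 := apply_eq_proj_add (C := C) hA y x
  rw [stepX_eq_sub]
  set q := proj C (stepParam A • y + A x) with hq
  set δ := stepY A C y x - y with hδ
  have hy : stepY A C y x = y + δ := by rw [hδ]; abel
  rw [norm_sub_sq_real, LinearMap.adjoint_inner_right, h2, hy, inner_add_left, inner_add_right,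
    real_inner_smul_left, real_inner_self_eq_norm_sq]
  have h3 := norm_sq_adjoint_apply_le A δ
  linarith

end Step

theorem sum_succ_sub_castSucc {G : Type*} [AddCommGroup G] {ℓ : ℕ} (f : Fin (ℓ + 1) → G) :
    ∑ i : Fin ℓ, (f i.succ - f i.castSucc) = f (Fin.last ℓ) - f 0 := by
  have h := Fin.sum_univ_succ f
  rw [Fin.sum_univ_castSucc] at h
  rw [Finset.sum_sub_distrib, sub_eq_sub_iff_add_eq_add, add_comm, ← h, add_comm]

section Iterates

variable {ℓ n : ℕ} {m : Fin ℓ → ℕ} (A : ∀ i, E n →ₗ[ℝ] E (m i)) (C : ∀ i, Set (E (m i)))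
  (v : E n)

/-- The inner points of the sweep performed at time `t`. -/
def sweepIter (t : ℕ) : Fin (ℓ + 1) → E n :=
  sweep A C (dualIter A C v t) (iterate A C v t).1

theorem sweepIter_zero (t : ℕ) : sweepIter A C v t 0 = (iterate A C v t).1 := rfl

theorem sweepIter_last (t : ℕ) :
    sweepIter A C v t (Fin.last ℓ) = (iterate A C v (t + 1)).1 := rfl

theorem sweepIter_succ (t : ℕ) (i : Fin ℓ) : sweepIter A C v t i.succ =
    stepX (A i) (C i) (dualIter A C v t i) (sweepIter A C v t i.castSucc) := by
  simp only [sweepIter, sweep, Fin.induction_succ]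

theorem dualIter_succ_apply (t : ℕ) (i : Fin ℓ) : dualIter A C v (t + 1) i =
    stepY (A i) (C i) (dualIter A C v t i) (sweepIter A C v t i.castSucc) := rfl

theorem sweepIter_succ_sub (t : ℕ) (i : Fin ℓ) :
    sweepIter A C v t i.succ - sweepIter A C v t i.castSucc =
      -LinearMap.adjoint (A i) (dualIter A C v (t + 1) i - dualIter A C v t i) := by
  rw [sweepIter_succ, stepX_eq_sub, dualIter_succ_apply]
  abel

/-- The primal iterate is determined by the dual iterate. -/
theorem iterate_fst_eq (t : ℕ) :
    (iterate A C v t).1 = v - stackedTranspose A (dualIter A C v t) := by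
  induction t with
  | zero => simp [iterate, dualIter, stackedTranspose]
  | succ t ih =>
    have h := sum_succ_sub_castSucc (sweepIter A C v t)
    simp only [sweepIter_succ_sub, sweepIter_last, sweepIter_zero, ih, map_sub,
      Finset.sum_neg_distrib, Finset.sum_sub_distrib] at h
    rw [eq_sub_iff_add_eq] at h
    rw [← h]
    simp only [stackedTranspose]
    abel

/-- The points of `D` attaining the support function at the dual iterates. -/
def supportIter (z₀ : DualSpace m) : ℕ → DualSpace m
  | 0 => z₀
  | t + 1 => WithLp.toLp 2 fun i => proj (C i)
      (stepParam (A i) • dualIter A C v t i + A i (sweepIter A C v t i.castSucc))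

variable {A C}

theorem supportIter_mem (hclosed : ∀ i, IsClosed (C i)) {z₀ : DualSpace m} (hz₀ : z₀ ∈ prodSet C)
    (t : ℕ) : supportIter A C v z₀ t ∈ prodSet C := by
  cases t with
  | zero => exact hz₀
  | succ t => exact fun i => (isNearest_proj (hclosed i) ⟨_, hz₀ i⟩ _).1

theorem inner_dualIter_le (hA : ∀ i, A i ≠ 0) (hclosed : ∀ i, IsClosed (C i))
    (hconvex : ∀ i, Convex ℝ (C i)) (z₀ : DualSpace m) (t : ℕ) (i : Fin ℓ) {z : E (m i)}
    (hz : z ∈ C i) : (inner ℝ z (dualIter A C v t i) : ℝ) ≤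
      inner ℝ (supportIter A C v z₀ t i) (dualIter A C v t i) := by
  cases t with
  | zero => simp [dualIter, iterate]
  | succ t => exact inner_stepY_le (hA i) (hclosed i) (hconvex i) _ _ hz

variable (A C)

/-- The real value of the dual objective at the dual iterates. -/
def dualValue (z₀ : DualSpace m) (t : ℕ) : ℝ :=
  1 / 2 * ‖(iterate A C v t).1‖ ^ 2 - 1 / 2 * ‖v‖ ^ 2
    + inner ℝ (supportIter A C v z₀ t) (dualIter A C v t)

variable {A C}

theorem dualObj_dualIter (hA : ∀ i, A i ≠ 0) (hclosed : ∀ i, IsClosed (C i))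
    (hconvex : ∀ i, Convex ℝ (C i)) {z₀ : DualSpace m} (hz₀ : z₀ ∈ prodSet C) (t : ℕ) :
    dualObj A C v (dualIter A C v t) = dualValue A C v z₀ t := by
  rw [dualObj_eq_of_attained A v (supportIter_mem v hclosed hz₀ t), dualValue, iterate_fst_eq,
    norm_sub_rev]
  intro z hz
  rw [dual_inner_eq_sum, dual_inner_eq_sum]
  exact Finset.sum_le_sum fun i _ => inner_dualIter_le v hA hclosed hconvex z₀ t i (hz i)

theorem dualValue_descent (hA : ∀ i, A i ≠ 0) (hclosed : ∀ i, IsClosed (C i))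
    (hconvex : ∀ i, Convex ℝ (C i)) {z₀ : DualSpace m} (hz₀ : z₀ ∈ prodSet C) (t : ℕ) :
    dualValue A C v z₀ (t + 1)
        + ∑ i, stepParam (A i) / 2 * ‖dualIter A C v (t + 1) i - dualIter A C v t i‖ ^ 2
      ≤ dualValue A C v z₀ t := by
  have h := sum_succ_sub_castSucc fun i => 1 / 2 * ‖sweepIter A C v t i‖ ^ 2
  simp only [sweepIter_last, sweepIter_zero] at h
  have h1 : ∀ i, stepParam (A i) / 2 * ‖dualIter A C v (t + 1) i - dualIter A C v t i‖ ^ 2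
      ≤ -(1 / 2 * ‖sweepIter A C v t i.succ‖ ^ 2 - 1 / 2 * ‖sweepIter A C v t i.castSucc‖ ^ 2)
        - inner ℝ (supportIter A C v z₀ (t + 1) i) (dualIter A C v (t + 1) i)
        + inner ℝ (supportIter A C v z₀ t i) (dualIter A C v t i) := fun i => by
    have h2 := block_descent (hA i) (hclosed i) (sweepIter A C v t i.castSucc)
      (fun z hz => inner_dualIter_le v hA hclosed hconvex z₀ t i hz) ⟨_, hz₀ i⟩
    rw [← sweepIter_succ, ← dualIter_succ_apply] at h2
    have h3 : supportIter A C v z₀ (t + 1) i = proj (C i)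
      (stepParam (A i) • dualIter A C v t i + A i (sweepIter A C v t i.castSucc)) := rfl
    rw [h3]
    linarith
  have h4 := Finset.sum_le_sum fun i (_ : i ∈ Finset.univ) => h1 i
  simp only [Finset.sum_add_distrib, Finset.sum_sub_distrib (f := fun i =>
    -(1 / 2 * ‖sweepIter A C v t (Fin.succ i)‖ ^ 2
      - 1 / 2 * ‖sweepIter A C v t (Fin.castSucc i)‖ ^ 2)), Finset.sum_neg_distrib, h] at h4
  rw [← dual_inner_eq_sum, ← dual_inner_eq_sum] at h4
  simp only [dualValue]
  linarith

theorem dualValue_antitone (hA : ∀ i, A i ≠ 0) (hclosed : ∀ i, IsClosed (C i))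
    (hconvex : ∀ i, Convex ℝ (C i)) {z₀ : DualSpace m} (hz₀ : z₀ ∈ prodSet C) :
    Antitone (dualValue A C v z₀) := by
  refine antitone_nat_of_succ_le fun t => ?_
  have h := dualValue_descent v hA hclosed hconvex hz₀ t
  have h1 : 0 ≤ ∑ i, stepParam (A i) / 2 * ‖dualIter A C v (t + 1) i - dualIter A C v t i‖ ^ 2 :=
    Finset.sum_nonneg fun i _ => by have := stepParam_pos (hA i); positivity
  linarith

theorem dualValue_zero (z₀ : DualSpace m) : dualValue A C v z₀ 0 = 0 := by
  simp [dualValue, iterate, dualIter]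

theorem tendsto_dualIter_sub (hA : ∀ i, A i ≠ 0) (hclosed : ∀ i, IsClosed (C i))
    (hconvex : ∀ i, Convex ℝ (C i)) {z₀ : DualSpace m} (hz₀ : z₀ ∈ prodSet C)
    (hbdd : BddBelow (Set.range (dualValue A C v z₀))) (i : Fin ℓ) :
    Tendsto (fun t => dualIter A C v (t + 1) i - dualIter A C v t i) atTop (𝓝 0) := by
  have hlim := tendsto_atTop_ciInf (dualValue_antitone v hA hclosed hconvex hz₀) hbdd
  have hdiff := hlim.sub (hlim.comp (tendsto_add_atTop_nat 1))
  rw [sub_self] at hdiff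
  have hpos := stepParam_pos (hA i)
  have hsq : Tendsto (fun t => ‖dualIter A C v (t + 1) i - dualIter A C v t i‖ ^ 2) atTop
      (𝓝 0) := by
    have h2 := hdiff.const_mul (2 / stepParam (A i))
    rw [mul_zero] at h2
    refine squeeze_zero (fun t => sq_nonneg _) (fun t => ?_) h2
    have h := dualValue_descent v hA hclosed hconvex hz₀ t
    have h3 := Finset.single_le_sum (f := fun i => stepParam (A i) / 2 *
      ‖dualIter A C v (t + 1) i - dualIter A C v t i‖ ^ 2)
      (fun j _ => by have := stepParam_pos (hA j); positivity) (Finset.mem_univ i)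
    simp only [Function.comp_apply] at h3 ⊢
    rw [div_mul_eq_mul_div, le_div_iff₀ hpos]
    linarith
  rw [tendsto_zero_iff_norm_tendsto_zero]
  simpa using hsq.sqrt

theorem tendsto_sweepIter_sub (hδ : ∀ i, Tendsto
      (fun t => dualIter A C v (t + 1) i - dualIter A C v t i) atTop (𝓝 0)) (i : Fin (ℓ + 1)) :
    Tendsto (fun t => sweepIter A C v t i - sweepIter A C v t 0) atTop (𝓝 0) := by
  induction i using Fin.induction with
  | zero => simp
  | succ i ih =>
    have h : Tendsto (fun t => -LinearMap.adjoint (A i)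
        (dualIter A C v (t + 1) i - dualIter A C v t i)) atTop (𝓝 0) := by
      have := ((LinearMap.continuous_of_finiteDimensional
        (LinearMap.adjoint (A i))).tendsto 0).comp (hδ i)
      rw [map_zero] at this
      simpa using this.neg
    have h2 := h.add ih
    rw [add_zero] at h2
    refine h2.congr fun t => ?_
    rw [← sweepIter_succ_sub]
    abel

/-- The residuals in the optimality conditions tend to zero. -/
theorem tendsto_residual (hA : ∀ i, A i ≠ 0) (z₀ : DualSpace m) (hδ : ∀ i, Tendsto
      (fun t => dualIter A C v (t + 1) i - dualIter A C v t i) atTop (𝓝 0)) (i : Fin ℓ) :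
    Tendsto (fun t => supportIter A C v z₀ (t + 1) i - A i (iterate A C v (t + 1)).1) atTop
      (𝓝 0) := by
  have h1 := (tendsto_sweepIter_sub v hδ i.castSucc).sub
    (tendsto_sweepIter_sub v hδ (Fin.last ℓ))
  have h2 := ((LinearMap.continuous_of_finiteDimensional (A i)).tendsto _).comp h1
  have h3 := h2.sub ((hδ i).const_smul (stepParam (A i)))
  rw [smul_zero, sub_zero, sub_zero, map_zero] at h3
  refine h3.congr fun t => ?_
  have h4 := apply_eq_proj_add (C := C i) (hA i) (dualIter A C v t i)
    (sweepIter A C v t i.castSucc)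
  have h5 : supportIter A C v z₀ (t + 1) i = proj (C i)
      (stepParam (A i) • dualIter A C v t i + A i (sweepIter A C v t i.castSucc)) := rfl
  rw [← h5, ← dualIter_succ_apply] at h4
  rw [Function.comp_apply, sub_sub_sub_cancel_right, map_sub, h4, sweepIter_last]
  abel

/-- The convexity estimate bounding the suboptimality by the residuals. -/
theorem dualValue_le_add (hclosed : ∀ i, IsClosed (C i)) {z₀ : DualSpace m}
    (hz₀ : z₀ ∈ prodSet C) (t : ℕ) (z : DualSpace m) {c : ℝ} (hc : dualObj A C v z ≤ c) :
    dualValue A C v z₀ t ≤ c + ∑ i, ‖supportIter A C v z₀ t i - A i (iterate A C v t).1‖ *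
      ‖dualIter A C v t - z‖ := by
  have h := (le_dualObj A v z (supportIter_mem (A := A) v hclosed hz₀ t)).trans hc
  rw [EReal.coe_le_coe_iff] at h
  set y := dualIter A C v t
  set p := supportIter A C v z₀ t
  set x := (iterate A C v t).1 with hx
  have h1 : stackedTranspose A z - v = -(x + stackedTranspose A (y - z)) := by
    rw [hx, iterate_fst_eq, sub_eq_add_neg y, stackedTranspose_add, ← neg_one_smul ℝ z,
      stackedTranspose_smul]
    module
  rw [h1, norm_neg, norm_add_sq_real, inner_stackedTranspose] at h
  have h2 : (inner ℝ p y : ℝ) - inner ℝ p z - ∑ i, inner ℝ (A i x) ((y - z) i)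
      = ∑ i, inner ℝ (p i - A i x) ((y - z) i) := by
    rw [← inner_sub_right, dual_inner_eq_sum, ← Finset.sum_sub_distrib]
    simp only [inner_sub_left]
  have h3 : ∑ i, inner ℝ (p i - A i x) ((y - z) i) ≤ ∑ i, ‖p i - A i x‖ * ‖y - z‖ :=
    Finset.sum_le_sum fun i _ => (real_inner_le_norm _ _).trans
      (mul_le_mul_of_nonneg_left (PiLp.norm_apply_le (y - z) i) (norm_nonneg _))
  have h4 := sq_nonneg ‖stackedTranspose A (y - z)‖
  simp only [dualValue]
  linarith

end Iterates

end DykstraMSF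

end

theorem theorem3p4 {ℓ n : ℕ} {m : Fin ℓ → ℕ}
    (A : ∀ i : Fin ℓ, DykstraMSF.E n →ₗ[ℝ] DykstraMSF.E (m i)) (hA : ∀ i, A i ≠ 0)
    (C : ∀ i : Fin ℓ, Set (DykstraMSF.E (m i)))
    (hclosed : ∀ i, IsClosed (C i)) (hconvex : ∀ i, Convex ℝ (C i))
    (hri : (⋂ i, A i ⁻¹' intrinsicInterior ℝ (C i)).Nonempty)
    (v : DykstraMSF.E n) :
    (DykstraMSF.dualArgmin A C v).Nonempty ∧
    Tendsto (fun t => DykstraMSF.dualObj A C v (DykstraMSF.dualIter A C v t)) atTop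
      (𝓝 (DykstraMSF.dualOpt A C v)) ∧
    Tendsto (fun t => Metric.infDist (DykstraMSF.dualIter A C v t)
      (DykstraMSF.dualArgmin A C v)) atTop (𝓝 0) := by
  open DykstraMSF in
  obtain ⟨x₀, hx₀⟩ := hri
  replace hx₀ : ∀ i, A i x₀ ∈ intrinsicInterior ℝ (C i) := fun i => Set.mem_iInter.1 hx₀ i
  have hx₀C : ∀ i, A i x₀ ∈ C i := fun i => intrinsicInterior_subset (hx₀ i)
  set z₀ : DualSpace m := WithLp.toLp 2 fun i => A i x₀
  have hz₀ : z₀ ∈ prodSet C := hx₀C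
  set K := (factorMap A C).ker
  have hlsc := lowerSemicontinuous_dualObj A C v
  have hinv : ∀ y, ∀ k ∈ K, dualObj A C v (y + k) = dualObj A C v y :=
    dualObj_add_of_mem_ker v hx₀C
  obtain ⟨R, hR⟩ := exists_bound_of_dualObj_le_zero (A := A) v hx₀
  have hval : ∀ t, dualObj A C v (dualIter A C v t) = dualValue A C v z₀ t :=
    dualObj_dualIter v hA hclosed hconvex hz₀
  have hle0 : ∀ t, dualObj A C v (dualIter A C v t) ≤ 0 := fun t => by
    rw [hval, ← EReal.coe_zero, EReal.coe_le_coe_iff, ← dualValue_zero (A := A) (C := C) v z₀]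
    exact dualValue_antitone v hA hclosed hconvex hz₀ (Nat.zero_le t)
  obtain ⟨ys, hysK, hys⟩ := exists_minimizer_of_invariant hlsc hinv hR ⟨_, hle0 0⟩
  have hopt : dualOpt A C v = dualObj A C v ys :=
    le_antisymm (iInf_le _ ys) (le_iInf hys)
  obtain ⟨c, hc⟩ : ∃ c : ℝ, dualObj A C v ys = c := by
    refine ⟨_, (EReal.coe_toReal ?_ ?_).symm⟩
    · exact ne_top_of_le_ne_top (EReal.coe_ne_top 0) ((hys _).trans (hle0 0))
    · exact ne_bot_of_le_ne_bot (EReal.coe_ne_bot _) (le_dualObj A v ys hz₀)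
  have hcle : ∀ t, c ≤ dualValue A C v z₀ t := fun t => by
    rw [← EReal.coe_le_coe_iff, ← hc, ← hval]
    exact hys _
  have hδ := tendsto_dualIter_sub v hA hclosed hconvex hz₀
    ⟨c, by rintro _ ⟨t, rfl⟩; exact hcle t⟩
  have hupper : ∀ t, dualValue A C v z₀ (t + 1) ≤ c + ∑ i, ‖supportIter A C v z₀ (t + 1) i
      - A i (iterate A C v (t + 1)).1‖ * (R + R) := fun t => by
    set y := dualIter A C v (t + 1)
    have hk : y - Kᗮ.starProjection y ∈ K := by
      have := Submodule.sub_starProjection_mem_orthogonal (K := Kᗮ) y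
      rwa [Submodule.orthogonal_orthogonal] at this
    refine (dualValue_le_add v hclosed hz₀ (t + 1) (ys + (y - Kᗮ.starProjection y))
      (c := c) (by rw [hinv _ _ hk, hc])).trans ?_
    refine add_le_add le_rfl (Finset.sum_le_sum fun i _ =>
      mul_le_mul_of_nonneg_left ?_ (norm_nonneg _))
    have h1 : y - (ys + (y - Kᗮ.starProjection y)) = Kᗮ.starProjection y - ys := by abel
    change ‖y - (ys + (y - Kᗮ.starProjection y))‖ ≤ _
    rw [h1]
    refine (norm_sub_le _ _).trans (add_le_add (hR _ (Submodule.starProjection_apply_mem _ _) ?_)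
      (hR _ hysK ((hys _).trans (hle0 0))))
    rw [apply_starProjection_orthogonal hinv]
    exact hle0 _
  have hres : Tendsto (fun t => c + ∑ i, ‖supportIter A C v z₀ (t + 1) i
      - A i (iterate A C v (t + 1)).1‖ * (R + R)) atTop (𝓝 c) := by
    have h := tendsto_finsetSum Finset.univ fun i (_ : i ∈ Finset.univ) =>
      ((tendsto_residual v hA z₀ hδ i).norm.mul_const (R + R))
    simpa using h.const_add c
  have hlim : Tendsto (dualValue A C v z₀) atTop (𝓝 c) :=
    (tendsto_add_atTop_iff_nat 1).1 (tendsto_of_tendsto_of_tendsto_of_le_of_le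
      tendsto_const_nhds hres (fun t => hcle (t + 1)) hupper)
  have hlimE : Tendsto (fun t => dualObj A C v (dualIter A C v t)) atTop
      (𝓝 (dualOpt A C v)) := by
    rw [hopt, hc]
    simp only [hval]
    exact (continuous_coe_real_ereal.tendsto c).comp hlim
  exact ⟨⟨ys, hys⟩, hlimE, tendsto_infDist_argmin_of_invariant hlsc hinv hR hle0 hlimE⟩
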